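/- **Theorem 3.9.** Let $G_0$ and $G_1$ be arbitrary finite matroids (loops and parallel elements are allowed), let $R$ be a commutative ring, and let $p$ and $q$ be points of the ground sets of $G_0$ and $G_1$, respectively. Let $P(G_0,G_1)$ be a parallel connection of $G_0$ and $G_1$ at $p$ and $q$, i.e. a matroid with a base point $b$ that is a union of pointed submatroids isomorphic to $(G_0,p)$ and $(G_1,q)$ whose ground sets meet only in the base point $b$, and that has the largest rank among all such unions (for $p,q$ not loops it exists and is unique up to isomorphism). Let $\{0\}$ denote the matroid of rank one with a single point, an isthmus. Then the matroids $$G=G_0\oplus G_1\qquad\text{and}\qquad G'=\{0\}\oplus P(G_0,G_1)$$ have isomorphic Orlik–Solomon algebras: there is an isomorphism of graded $R$-algebras $\mathcal A(G)\cong\mathcal A(G')$. Here, for a matroid $M$ with finite ground set $E$, $\mathcal A(M)=\mathcal E/\mathcal I$, where $\mathcal E=\Lambda_R(e_i : i\in E)$ is the exterior algebra over $R$ with its standard grading and $\mathcal I$ is the two-sided ideal generated by all $$\partial(e_{i_1}\wedge\cdots\wedge e_{i_n})=\sum_{k=1}^n(-1)^{k-1}e_{i_1}\wedge\cdots\wedge\widehat{e}_{i_k}\wedge\cdots\wedge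 e_{i_n}$$ with $\{i_1,\dots,i_n\}$ dependent in $M$. -/

import Mathlib

noncomputable section

namespace OrlikSolomon

open scoped Matroid

/-- The generator `e_i` of the exterior algebra `Λ(e_i : i ∈ X)` on the free module with basis
`X`. -/
def gen (R : Type*) [CommRing R] {X : Type*} (i : X) : ExteriorAlgebra R (X →₀ R) :=
  ExteriorAlgebra.ι R (Finsupp.single i 1)

/-- The monomial `e_S = e_{i_1} ∧ ⋯ ∧ e_{i_n}` of an ordered tuple `S = (i_1, …, i_n)`. -/
def monomial (R : Type*) [CommRing R] {X : Type*} {n : ℕ} (S : Fin n → X) :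
    ExteriorAlgebra R (X →₀ R) :=
  (List.ofFn fun k => gen R (S k)).prod

/-- The boundary map `∂` of the exterior algebra: the left contraction with the linear form
that takes the value `1` on each basis vector. Its values on monomials are the usual alternating
sums, see `boundary_monomial`. -/
def boundary (R : Type*) [CommRing R] (X : Type*) :
    ExteriorAlgebra R (X →₀ R) →ₗ[R] ExteriorAlgebra R (X →₀ R) :=
  CliffordAlgebra.contractLeft (Q := (0 : QuadraticForm R (X →₀ R)))
    (Finsupp.linearCombination R fun _ : X => (1 : R))

/-- `∂(e_{i_0} ∧ ⋯ ∧ e_{i_n}) = ∑_k (-1)^k e_{i_0} ∧ ⋯ ∧ ê_{i_k} ∧ ⋯ ∧ e_{i_n}` (with indices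
counted from `0`). -/
theorem boundary_monomial (R : Type*) [CommRing R] {X : Type*} {n : ℕ} (S : Fin (n + 1) → X) :
    boundary R X (monomial R S) =
      ∑ k : Fin (n + 1), (-1 : R) ^ (k : ℕ) • monomial R (fun j => S (k.succAbove j)) := by
  have key : ∀ {m : ℕ} (T : Fin (m + 1) → X), boundary R X (monomial R T) =
      monomial R (fun j => T j.succ) -
        gen R (T 0) * boundary R X (monomial R (fun j => T j.succ)) := by
    intro m T
    have h := CliffordAlgebra.contractLeft_ι_mul (Q := (0 : QuadraticForm R (X →₀ R)))
      (Finsupp.linearCombination R fun _ : X => (1 : R)) (Finsupp.single (T 0) 1)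
      (monomial R (fun j => T j.succ))
    simp only [Finsupp.linearCombination_single, smul_eq_mul, mul_one, one_smul] at h
    simpa [boundary, monomial, gen, List.ofFn_succ, ExteriorAlgebra.ι] using h
  induction n with
  | zero =>
    rw [key]
    have h1 : boundary R X (monomial R (fun j : Fin 0 => S j.succ)) = 0 := by
      simp [boundary, monomial]
    rw [h1]
    simp [monomial]
  | succ n ih =>
    rw [key, ih, Fin.sum_univ_succ (n := n + 1), sub_eq_add_neg, Finset.mul_sum,
      ← Finset.sum_neg_distrib]
    congr 1
    · simp
    · refine Finset.sum_congr rfl fun k _ => ?_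
      simp [monomial, List.ofFn_succ, pow_succ]

/-- The Orlik–Solomon ideal of `M`: the two-sided ideal of `Λ(e_i : i ∈ M.E)` generated by all
`∂ e_S` with `S` dependent. -/
def osIdeal (R : Type*) [CommRing R] {α : Type*} (M : Matroid α) :
    Ideal (ExteriorAlgebra R (M.E →₀ R)) :=
  (TwoSidedIdeal.span {x | ∃ (n : ℕ) (S : Fin n → M.E),
    M.Dep (Set.range fun k => (S k : α)) ∧ x = boundary R M.E (monomial R S)}).asIdeal

instance (R : Type*) [CommRing R] {α : Type*} (M : Matroid α) : (osIdeal R M).IsTwoSided :=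
  inferInstanceAs (TwoSidedIdeal.asIdeal _).IsTwoSided

/-- The Orlik–Solomon algebra of the matroid `M` with coefficients in `R`. -/
abbrev OSAlgebra (R : Type*) [CommRing R] {α : Type*} (M : Matroid α) : Type _ :=
  ExteriorAlgebra R (M.E →₀ R) ⧸ osIdeal R M

/-- The homogeneous part of degree `n` of the Orlik–Solomon algebra: the image of `Λⁿ`. -/
def osDegree (R : Type*) [CommRing R] {α : Type*} (M : Matroid α) (n : ℕ) :
    Submodule R (OSAlgebra R M) :=
  (⋀[R]^n (M.E →₀ R)).map (Ideal.Quotient.mkₐ R (osIdeal R M)).toLinearMap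

/-- `M` and `N` have isomorphic Orlik–Solomon algebras, as graded `R`-algebras. -/
def HasIsomorphicOSAlgebras (R : Type*) [CommRing R] {α β : Type*} (M : Matroid α)
    (N : Matroid β) : Prop :=
  ∃ φ : OSAlgebra R M ≃ₐ[R] OSAlgebra R N,
    ∀ n : ℕ, (osDegree R M n).map φ.toLinearMap = osDegree R N n

/-- `f` identifies `M` with the submatroid of `P` on the set `f '' M.E`. -/
structure IsSubmatroidEmbedding {α γ : Type*} (M : Matroid α) (P : Matroid γ) (f : α → γ) :
    Prop where
  injOn : Set.InjOn f M.E
  image_subset : f '' M.E ⊆ P.E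
  restrict_eq : P ↾ (f '' M.E) = M.map f injOn

/-- The matroid `P` with base point `b` is the union of two pointed submatroids, isomorphic to
`G₀` with base point `p` and to `G₁` with base point `q`, whose ground sets meet only in `b`. -/
def IsPointedUnion {α β γ : Type*} (G₀ : Matroid α) (p : α) (G₁ : Matroid β) (q : β)
    (P : Matroid γ) (b : γ) : Prop :=
  p ∈ G₀.E ∧ q ∈ G₁.E ∧ ∃ (f₀ : α → γ) (f₁ : β → γ),
    IsSubmatroidEmbedding G₀ P f₀ ∧ IsSubmatroidEmbedding G₁ P f₁ ∧
    f₀ p = b ∧ f₁ q = b ∧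
    P.E = (f₀ '' G₀.E) ∪ (f₁ '' G₁.E) ∧
    (f₀ '' G₀.E) ∩ (f₁ '' G₁.E) = {b}

/-- `(P, b)` is a parallel connection of the pointed matroids `(G₀, p)` and `(G₁, q)`: a pointed
union of copies of them of the largest possible rank. All pointed unions of (finite) `G₀` and `G₁`
have equally large ground sets, so up to isomorphism it is enough to compare with those that live
in the same type. -/
structure IsParallelConnection {α β γ : Type*} (G₀ : Matroid α) (p : α) (G₁ : Matroid β) (q : β)
    (P : Matroid γ) (b : γ) : Prop where
  isPointedUnion : IsPointedUnion G₀ p G₁ q P b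
  eRank_le : ∀ (P' : Matroid γ) (b' : γ), IsPointedUnion G₀ p G₁ q P' b' → P'.eRank ≤ P.eRank

/-- The matroid `{0}` of rank one with a single point, an isthmus. -/
def isthmus : Matroid Unit := Matroid.freeOn Set.univ

end OrlikSolomon

end

/-!
Every dependent set of `G₀ ⊕ G₁` contains one of a summand. As `P` has maximal rank, every dependent
set of `P` contains one of the two submatroids, or the union of two sets that become dependent in
the respective submatroids when the base point `b` is added, and the monomials of such unions lie in
the ideal generated by the boundaries of these two dependent sets. Hence the Orlik–Solomon ideals of
both `G₀ ⊕ G₁` and `{0} ⊕ P` are generated by the boundaries of the dependent sets of `G₀` and `G₁`.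
By `∂(e_a ∧ e_S) = ⋀_{x ∈ S} (e_x - e_a)` such a boundary involves only differences of basis vectors
of a single summand, and the linear isomorphism `e_x ↦ e_{f₀ x}` on `G₀`,
`e_y ↦ e_{f₁ y} + e_0 - e_b` on `G₁` preserves these differences (it maps `e_q` to `e_0`).

The lower bound on the rank of `P` comes from the pointed union that one obtains from `G₀ ⊕ G₁`
by adding a point freely to the line through `p` and `q` and contracting it.
-/

noncomputable section

namespace OrlikSolomon

open scoped Matroid
open CliffordAlgebra (contractLeft involute)
open ExteriorAlgebra (ι)

section Clifford

variable {R V : Type*} [CommRing R] [AddCommGroup V] [Module R V] {Q : QuadraticForm R V}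

theorem contractLeft_mul (d : Module.Dual R V) (x y : CliffordAlgebra Q) :
    contractLeft d (x * y) = contractLeft d x * y + involute x * contractLeft d y := by
  induction x using CliffordAlgebra.left_induction with
  | algebraMap r =>
    simp [CliffordAlgebra.contractLeft_algebraMap_mul, CliffordAlgebra.contractLeft_algebraMap]
  | add x₁ x₂ h₁ h₂ => simp only [add_mul, map_add, h₁, h₂]; abel
  | ι_mul x v h =>
    simp only [mul_assoc, CliffordAlgebra.contractLeft_ι_mul, h, map_mul,
      CliffordAlgebra.involute_ι, sub_mul, smul_mul_assoc]
    noncomm_ring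

theorem ι_mul_eq_involute_mul (v : V) (x : ExteriorAlgebra R V) :
    ι R v * x = involute x * ι R v := by
  induction x using CliffordAlgebra.left_induction with
  | algebraMap r => rw [AlgHom.commutes, Algebra.commutes]
  | add x₁ x₂ h₁ h₂ => simp only [map_add, mul_add, add_mul, h₁, h₂]
  | ι_mul x w h =>
    have swap : ι R v * ι R w = -(ι R w * ι R v) :=
      eq_neg_of_add_eq_zero_left (ExteriorAlgebra.ι_add_mul_swap v w)
    rw [map_mul, CliffordAlgebra.involute_ι, mul_assoc, ← h, ← mul_assoc, ← mul_assoc, neg_mul]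
    exact congrArg (· * x) swap

theorem ι_mul_mul_ι_self (v : V) (x : ExteriorAlgebra R V) : ι R v * x * ι R v = 0 := by
  rw [ι_mul_eq_involute_mul, mul_assoc, ExteriorAlgebra.ι_sq_zero, mul_zero]

end Clifford

section Boundary

variable {R : Type*} [CommRing R] {X Y : Type*}

theorem boundary_gen_mul (a : X) (x : ExteriorAlgebra R (X →₀ R)) :
    boundary R X (gen R a * x) = x - gen R a * boundary R X x := by
  refine (CliffordAlgebra.contractLeft_ι_mul _ _ x).trans ?_
  rw [Finsupp.linearCombination_single, smul_eq_mul, mul_one, one_smul]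
  rfl

theorem boundary_one : boundary R X 1 = 0 :=
  CliffordAlgebra.contractLeft_one (Q := (0 : QuadraticForm R (X →₀ R))) _

theorem boundary_boundary (x : ExteriorAlgebra R (X →₀ R)) : boundary R X (boundary R X x) = 0 :=
  CliffordAlgebra.contractLeft_contractLeft _ _

theorem boundary_mul (x y : ExteriorAlgebra R (X →₀ R)) :
    boundary R X (x * y) = boundary R X x * y + involute x * boundary R X y :=
  contractLeft_mul _ x y

variable (R) in
/-- The monomial `e_{i_1} ∧ ⋯ ∧ e_{i_n}` of a list. Its support is the set `{i | i ∈ l}`; lists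
replace the tuples of `monomial` for the sake of concatenation and permutation. -/
def listMonomial (l : List X) : ExteriorAlgebra R (X →₀ R) := (l.map (gen R)).prod

@[simp] theorem listMonomial_nil : listMonomial R ([] : List X) = 1 := rfl

@[simp] theorem listMonomial_cons (a : X) (l : List X) :
    listMonomial R (a :: l) = gen R a * listMonomial R l := by simp [listMonomial]

theorem listMonomial_append (l l' : List X) :
    listMonomial R (l ++ l') = listMonomial R l * listMonomial R l' := by simp [listMonomial]

theorem monomial_eq_listMonomial {n : ℕ} (S : Fin n → X) :
    monomial R S = listMonomial R (List.ofFn S) := by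
  simp [monomial, listMonomial, List.map_ofFn, Function.comp_def]

theorem gen_mul_gen_swap (a b : X) : gen R a * gen R b = -(gen R b * gen R a) :=
  eq_neg_of_add_eq_zero_left (ExteriorAlgebra.ι_add_mul_swap _ _)

theorem listMonomial_perm {l l' : List X} (h : l.Perm l') :
    listMonomial R l = listMonomial R l' ∨ listMonomial R l = -listMonomial R l' := by
  induction h with
  | nil => simp
  | cons a _ ih => rcases ih with ih | ih <;> simp [ih]
  | swap a b l =>
    right
    simp only [listMonomial_cons, ← mul_assoc, gen_mul_gen_swap b a, neg_mul]
  | trans _ _ ih₁ ih₂ => rcases ih₁ with h | h <;> rcases ih₂ with h' | h' <;> simp [h, h']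

theorem gen_mul_listMonomial_of_mem {a : X} {l : List X} (h : a ∈ l) :
    gen R a * listMonomial R l = 0 := by
  obtain ⟨l₁, l₂, rfl⟩ := List.append_of_mem h
  rw [listMonomial_append, listMonomial_cons, ← mul_assoc, ← mul_assoc]
  simp only [gen, ι_mul_mul_ι_self, zero_mul]

theorem listMonomial_eq_gen_mul_boundary {a : X} {l : List X} (h : a ∈ l) :
    listMonomial R l = gen R a * boundary R X (listMonomial R l) := by
  rw [← sub_eq_zero, ← boundary_gen_mul, gen_mul_listMonomial_of_mem h, map_zero]

theorem boundary_listMonomial_cons (a : X) (l : List X) :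
    boundary R X (listMonomial R (a :: l)) =
      (l.map fun x => ι R (Finsupp.single x (1 : R) - Finsupp.single a 1)).prod := by
  induction l with
  | nil => simp only [listMonomial_cons, boundary_gen_mul, listMonomial_nil, boundary_one, mul_zero,
      sub_zero, List.map_nil, List.prod_nil]
  | cons x l ih =>
    have hsq : gen R a * gen R a = 0 := ExteriorAlgebra.ι_sq_zero _
    rw [List.map_cons, List.prod_cons, ← ih, map_sub, ← gen, ← gen]
    simp only [listMonomial_cons, boundary_gen_mul]
    simp only [mul_sub, sub_mul, ← mul_assoc, gen_mul_gen_swap a x, hsq, zero_mul, neg_mul]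
    abel

theorem involute_boundary_listMonomial (l : List X) :
    involute (boundary R X (listMonomial R l)) = boundary R X (listMonomial R l) ∨
      involute (boundary R X (listMonomial R l)) = -boundary R X (listMonomial R l) := by
  cases l with
  | nil => simp [boundary_one]
  | cons a l =>
    have := CliffordAlgebra.involute_prod_map_ι (Q := (0 : QuadraticForm R (X →₀ R)))
      (l.map fun x => Finsupp.single x 1 - Finsupp.single a 1)
    rw [List.map_map] at this
    rw [boundary_listMonomial_cons]
    rcases neg_one_pow_eq_or R (l.map fun x => Finsupp.single x (1 : R) - Finsupp.single a 1).length
      with h | h <;> rw [h] at this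
    · exact .inl (this.trans (one_smul _ _))
    · exact .inr (this.trans (neg_one_smul _ _))

theorem map_boundary_listMonomial {f : (X →₀ R) →ₗ[R] (Y →₀ R)} {σ : X → Y} {l : List X}
    (hf : ∀ x ∈ l, ∀ y ∈ l, f (Finsupp.single x 1 - Finsupp.single y 1) =
      Finsupp.single (σ x) 1 - Finsupp.single (σ y) 1) :
    ExteriorAlgebra.map f (boundary R X (listMonomial R l)) =
      boundary R Y (listMonomial R (l.map σ)) := by
  cases l with
  | nil => simp [boundary_one]
  | cons a l =>
    rw [List.map_cons, boundary_listMonomial_cons, boundary_listMonomial_cons, map_list_prod,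
      List.map_map, List.map_map]
    refine congrArg List.prod (List.map_congr_left fun x hx => ?_)
    rw [Function.comp_apply, ExteriorAlgebra.map_apply_ι,
      hf x (List.mem_cons_of_mem _ hx) a List.mem_cons_self, Function.comp_apply]

end Boundary

section BoundaryIdeal

variable {R : Type*} [CommRing R] {X Y : Type*} {C : Set (Set X)}

variable (R) in
/-- The two-sided ideal generated by the boundaries of the monomials with support in `C`. For the
dependent sets of a matroid this is the Orlik–Solomon ideal. -/
def boundaryIdeal (C : Set (Set X)) : TwoSidedIdeal (ExteriorAlgebra R (X →₀ R)) :=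
  TwoSidedIdeal.span {x | ∃ l : List X, {a | a ∈ l} ∈ C ∧ x = boundary R X (listMonomial R l)}

theorem boundary_listMonomial_mem {l : List X} (h : {a | a ∈ l} ∈ C) :
    boundary R X (listMonomial R l) ∈ boundaryIdeal R C :=
  TwoSidedIdeal.subset_span ⟨l, h, rfl⟩

theorem boundaryIdeal_le {I : TwoSidedIdeal (ExteriorAlgebra R (X →₀ R))}
    (h : ∀ l : List X, {a | a ∈ l} ∈ C → boundary R X (listMonomial R l) ∈ I) :
    boundaryIdeal R C ≤ I := by
  refine TwoSidedIdeal.span_le.2 ?_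
  rintro _ ⟨l, hl, rfl⟩
  exact h l hl

theorem involute_mem_boundaryIdeal {x : ExteriorAlgebra R (X →₀ R)}
    (hx : x ∈ boundaryIdeal R C) : involute x ∈ boundaryIdeal R C := by
  suffices boundaryIdeal R C ≤ (boundaryIdeal R C).comap involute from
    (TwoSidedIdeal.mem_comap _).1 (this hx)
  refine boundaryIdeal_le fun l hl => (TwoSidedIdeal.mem_comap _).2 ?_
  rcases involute_boundary_listMonomial (R := R) l with h | h <;> rw [h]
  · exact boundary_listMonomial_mem hl
  · exact neg_mem (boundary_listMonomial_mem hl)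

theorem boundary_mem_boundaryIdeal {x : ExteriorAlgebra R (X →₀ R)}
    (hx : x ∈ boundaryIdeal R C) : boundary R X x ∈ boundaryIdeal R C := by
  refine TwoSidedIdeal.span_induction (p := fun x _ => boundary R X x ∈ boundaryIdeal R C)
    ?_ ?_ ?_ ?_ ?_ ?_ hx
  · rintro _ ⟨l, -, rfl⟩
    exact boundary_boundary (R := R) _ ▸ zero_mem _
  · exact (map_zero (boundary R X)).symm ▸ zero_mem _
  · intro x y _ _ h₁ h₂
    exact map_add (boundary R X) x y ▸ add_mem h₁ h₂
  · intro x _ h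
    exact map_neg (boundary R X) x ▸ neg_mem h
  · intro a x hx h
    rw [boundary_mul]
    exact add_mem (TwoSidedIdeal.mul_mem_left _ _ _ hx) (TwoSidedIdeal.mul_mem_left _ _ _ h)
  · intro x a hx h
    rw [boundary_mul]
    exact add_mem (TwoSidedIdeal.mul_mem_right _ _ _ h)
      (TwoSidedIdeal.mul_mem_right _ _ _ (involute_mem_boundaryIdeal hx))

theorem listMonomial_mem_of_subset {I : TwoSidedIdeal (ExteriorAlgebra R (X →₀ R))}
    {l l' : List X} (hl' : l'.Nodup) (h : l' ⊆ l) (hI : listMonomial R l' ∈ I) :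
    listMonomial R l ∈ I := by
  obtain ⟨k, hk, hkl⟩ := List.subperm_of_subset hl' h
  obtain ⟨m, hm⟩ := hkl.exists_perm_append
  have hkm : listMonomial R (k ++ m) ∈ I := by
    rw [listMonomial_append]
    refine TwoSidedIdeal.mul_mem_right _ _ _ ?_
    rcases listMonomial_perm (R := R) hk with h | h <;> rw [h]
    exacts [hI, neg_mem hI]
  rcases listMonomial_perm (R := R) hm with h | h <;> rw [h]
  exacts [hkm, neg_mem hkm]

theorem exists_nodup_of_subset_support {s : Set X} {l : List X} (h : s ⊆ {a | a ∈ l}) :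
    ∃ l' : List X, l'.Nodup ∧ {a | a ∈ l'} = s :=
  have hs : s.Finite := l.finite_toSet.subset h
  ⟨hs.toFinset.toList, Finset.nodup_toList _, by ext; simp⟩

theorem listMonomial_mem_boundaryIdeal {s : Set X} (hs : s ∈ C) (hne : s.Nonempty)
    {l : List X} (hl : s ⊆ {a | a ∈ l}) : listMonomial R l ∈ boundaryIdeal R C := by
  obtain ⟨l', hnd, rfl⟩ := exists_nodup_of_subset_support hl
  obtain ⟨a, ha⟩ := hne
  refine listMonomial_mem_of_subset hnd hl ?_
  rw [listMonomial_eq_gen_mul_boundary ha]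
  exact TwoSidedIdeal.mul_mem_left _ _ _ (boundary_listMonomial_mem hs)

theorem listMonomial_mem_boundaryIdeal_of_insert {s t : Set X} {b : X} (hs : insert b s ∈ C)
    (ht : insert b t ∈ C) (hst : Disjoint s t) {l : List X} (hl : s ∪ t ⊆ {a | a ∈ l}) :
    listMonomial R l ∈ boundaryIdeal R C := by
  obtain ⟨ls, hls, rfl⟩ := exists_nodup_of_subset_support (Set.subset_union_left.trans hl)
  obtain ⟨lt, hlt, rfl⟩ := exists_nodup_of_subset_support (Set.subset_union_right.trans hl)
  have hmul : listMonomial R (ls ++ lt) =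
      listMonomial R ls * boundary R X (listMonomial R (b :: lt)) +
        boundary R X (listMonomial R (b :: ls)) * (gen R b * boundary R X (listMonomial R lt)) := by
    have hb : gen R b * boundary R X (listMonomial R ls) * gen R b = 0 := ι_mul_mul_ι_self _ _
    simp only [listMonomial_append, listMonomial_cons, boundary_gen_mul, mul_sub, sub_mul,
      ← mul_assoc, hb, zero_mul]
    abel
  have support_cons (m : List X) : {a | a ∈ b :: m} = insert b {a | a ∈ m} := by
    ext; simp
  refine listMonomial_mem_of_subset (hls.append hlt (Set.disjoint_left.1 hst))
    (fun a ha => hl (List.mem_append.1 ha)) (hmul ▸ add_mem ?_ ?_)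
  · exact TwoSidedIdeal.mul_mem_left _ _ _
      (boundary_listMonomial_mem ((support_cons lt).symm ▸ ht))
  · exact TwoSidedIdeal.mul_mem_right _ _ _
      (boundary_listMonomial_mem ((support_cons ls).symm ▸ hs))

theorem exists_list_map_eq {σ : X → Y} {s : Set X} (hσ : Set.InjOn σ s) {l : List Y}
    (hl : {y | y ∈ l} = σ '' s) : ∃ k : List X, {x | x ∈ k} = s ∧ k.map σ = l := by
  have hl' : l ∈ Set.range (List.map fun x : s => σ x) := by
    rw [Set.range_list_map, ← Set.image_eq_range, ← hl]
    exact fun _ => id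
  obtain ⟨k, rfl⟩ := hl'
  have hk : {x | x ∈ k.map Subtype.val} ⊆ s := by
    intro x hx
    obtain ⟨y, -, rfl⟩ := List.mem_map.1 hx
    exact y.2
  refine ⟨k.map Subtype.val, (hσ.image_eq_image_iff hk subset_rfl).1 ?_, List.map_map ..⟩
  rw [← hl]
  ext; simp

theorem map_mem_boundaryIdeal_iff (f : (X →₀ R) ≃ₗ[R] (Y →₀ R)) {σ : X → Y}
    (hσ : ∀ s ∈ C, Set.InjOn σ s)
    (hf : ∀ s ∈ C, ∀ x ∈ s, ∀ y ∈ s, f (Finsupp.single x 1 - Finsupp.single y 1) =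
      Finsupp.single (σ x) 1 - Finsupp.single (σ y) 1)
    (x : ExteriorAlgebra R (X →₀ R)) :
    ExteriorAlgebra.map f.toLinearMap x ∈ boundaryIdeal R (Set.image σ '' C) ↔
      x ∈ boundaryIdeal R C := by
  have map_symm_map (z) : ExteriorAlgebra.map f.symm.toLinearMap
      (ExteriorAlgebra.map f.toLinearMap z) = z := by
    rw [← AlgHom.comp_apply, ExteriorAlgebra.map_comp_map, LinearEquiv.symm_comp,
      ExteriorAlgebra.map_id, AlgHom.id_apply]
  constructor
  · suffices boundaryIdeal R (Set.image σ '' C) ≤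
        (boundaryIdeal R C).comap (ExteriorAlgebra.map f.symm.toLinearMap) from
      fun hx => map_symm_map x ▸ (TwoSidedIdeal.mem_comap _).1 (this hx)
    refine boundaryIdeal_le fun l ⟨s, hs, hl⟩ => (TwoSidedIdeal.mem_comap _).2 ?_
    obtain ⟨k, rfl, rfl⟩ := exists_list_map_eq (hσ s hs) hl.symm
    rw [← map_boundary_listMonomial (f := f.toLinearMap) (hf _ hs), map_symm_map]
    exact boundary_listMonomial_mem hs
  · suffices boundaryIdeal R C ≤ (boundaryIdeal R (Set.image σ '' C)).comap
        (ExteriorAlgebra.map f.toLinearMap) from fun hx => (TwoSidedIdeal.mem_comap _).1 (this hx)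
    refine boundaryIdeal_le fun l hl => (TwoSidedIdeal.mem_comap _).2 ?_
    rw [map_boundary_listMonomial (f := f.toLinearMap) (hf _ hl)]
    exact boundary_listMonomial_mem ⟨_, hl, by ext; simp⟩

end BoundaryIdeal

section OSIdeal

variable {R : Type*} [CommRing R]

theorem map_exteriorPower {V W : Type*} [AddCommGroup V] [Module R V] [AddCommGroup W]
    [Module R W] {f : V →ₗ[R] W} (hf : Function.Surjective f) (n : ℕ) :
    (⋀[R]^n V).map (ExteriorAlgebra.map f).toLinearMap = ⋀[R]^n W := by
  rw [Submodule.map_pow, ExteriorAlgebra.ι_range_map_map,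
    LinearMap.range_eq_top.2 hf, Submodule.map_top]

/-- The isomorphism of exterior algebras induced by an isomorphism of modules. -/
def exteriorMapEquiv {V W : Type*} [AddCommGroup V] [Module R V] [AddCommGroup W] [Module R W]
    (f : V ≃ₗ[R] W) : ExteriorAlgebra R V ≃ₐ[R] ExteriorAlgebra R W :=
  AlgEquiv.ofAlgHom (ExteriorAlgebra.map f.toLinearMap) (ExteriorAlgebra.map f.symm.toLinearMap)
    (by simp [ExteriorAlgebra.map_comp_map]) (by simp [ExteriorAlgebra.map_comp_map])

variable {α β : Type*} {M : Matroid α} {N : Matroid β}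

theorem hasIsomorphicOSAlgebras_of_linearEquiv (f : (M.E →₀ R) ≃ₗ[R] (N.E →₀ R))
    (hf : ∀ x, ExteriorAlgebra.map f.toLinearMap x ∈ osIdeal R N ↔ x ∈ osIdeal R M) :
    HasIsomorphicOSAlgebras R M N := by
  have hideal : osIdeal R N = (osIdeal R M).map (exteriorMapEquiv f : _ →+* _) := by
    rw [← show (osIdeal R N).comap (exteriorMapEquiv f : _ →+* _) = osIdeal R M from Ideal.ext hf]
    exact (Ideal.map_comap_of_surjective _ (exteriorMapEquiv f).surjective _).symm
  refine ⟨Ideal.quotientEquivAlg _ _ (exteriorMapEquiv f) hideal, fun n => ?_⟩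
  rw [osDegree, osDegree, ← map_exteriorPower f.surjective n, ← Submodule.map_comp,
    ← Submodule.map_comp]
  rfl

variable (R) in
theorem osIdeal_eq_boundaryIdeal (M : Matroid α) :
    osIdeal R M = (boundaryIdeal R {s : Set M.E | M.Dep (Subtype.val '' s)}).asIdeal := by
  rw [osIdeal, boundaryIdeal]
  congr 2
  ext x
  constructor
  · rintro ⟨n, S, hS, rfl⟩
    refine ⟨List.ofFn S, ?_, by rw [monomial_eq_listMonomial]⟩
    have : Subtype.val '' {a | a ∈ List.ofFn S} = Set.range fun k => (S k : α) := by
      ext; simp [List.mem_ofFn]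
    rwa [Set.mem_ofPred_eq, this]
  · rintro ⟨l, hl, rfl⟩
    refine ⟨l.length, l.get, ?_, by rw [monomial_eq_listMonomial, List.ofFn_get]⟩
    have : (Set.range fun k => (l.get k : α)) = Subtype.val '' {a | a ∈ l} := by
      rw [Set.range_comp' Subtype.val, Set.range_list_get]
    rwa [this]

/-- The dependent sets of `M` are generated by those in the family `C`, by passing to supersets and
by eliminating a common element `b` from two members of `C` that are disjoint away from `b`. -/
structure GeneratesDep (M : Matroid α) (C : Set (Set α)) : Prop where
  dep : ∀ ⦃s⦄, s ∈ C → M.Dep s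
  exists_of_dep : ∀ ⦃S⦄, M.Dep S → (∃ s ∈ C, s ⊆ S) ∨
    ∃ b s t, insert b s ∈ C ∧ insert b t ∈ C ∧ Disjoint s t ∧ s ∪ t ⊆ S

namespace GeneratesDep

variable {C : Set (Set α)} {D : Set (Set β)}

theorem boundary_mem_boundaryIdeal (hC : GeneratesDep M C) {l : List M.E}
    (hl : M.Dep (Subtype.val '' {a | a ∈ l})) :
    boundary R M.E (listMonomial R l) ∈ boundaryIdeal R (Set.image Subtype.val ⁻¹' C) := by
  apply OrlikSolomon.boundary_mem_boundaryIdeal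
  rcases hC.exists_of_dep hl with ⟨s, hs, hsl⟩ | ⟨b, s, t, hs, ht, hst, hsub⟩
  · obtain ⟨s, hsl', rfl⟩ := Set.subset_image_iff.1 hsl
    exact listMonomial_mem_boundaryIdeal (C := Set.image Subtype.val ⁻¹' C) hs
      (hC.dep hs).nonempty.of_image hsl'
  · obtain ⟨u, hul, hu⟩ := Set.subset_image_iff.1 hsub
    obtain ⟨s, hsu, rfl⟩ := Set.subset_image_iff.1 (Set.subset_union_left.trans hu.superset)
    obtain ⟨t, htu, rfl⟩ := Set.subset_image_iff.1 (Set.subset_union_right.trans hu.superset)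
    lift b to M.E using (hC.dep hs).subset_ground (Set.mem_insert _ _)
    rw [← Set.image_insert_eq] at hs ht
    exact listMonomial_mem_boundaryIdeal_of_insert hs ht hst.of_image
      (Set.union_subset (hsu.trans hul) (htu.trans hul))

variable (R) in
theorem osIdeal_eq (hC : GeneratesDep M C) :
    osIdeal R M = (boundaryIdeal R (Set.image Subtype.val ⁻¹' C)).asIdeal := by
  rw [osIdeal_eq_boundaryIdeal]
  exact congrArg _ (le_antisymm (boundaryIdeal_le fun l hl => hC.boundary_mem_boundaryIdeal hl)
    (boundaryIdeal_le fun l hl => boundary_listMonomial_mem (hC.dep hl)))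

theorem hasIsomorphicOSAlgebras {σ : α → β} (hσ : Set.MapsTo σ M.E N.E) (hC : GeneratesDep M C)
    (hD : GeneratesDep N (Set.image σ '' C)) (hinj : ∀ s ∈ C, Set.InjOn σ s)
    (f : (M.E →₀ R) ≃ₗ[R] (N.E →₀ R))
    (hf : ∀ s ∈ C, ∀ x y : M.E, ↑x ∈ s → ↑y ∈ s →
      f (Finsupp.single x 1 - Finsupp.single y 1) =
        Finsupp.single (hσ.restrict σ _ _ x) 1 - Finsupp.single (hσ.restrict σ _ _ y) 1) :
    HasIsomorphicOSAlgebras R M N := by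
  have himage : Set.image Subtype.val ⁻¹' (Set.image σ '' C) =
      Set.image (hσ.restrict σ _ _) '' (Set.image Subtype.val ⁻¹' C) := by
    have comm (s : Set M.E) :
        Subtype.val '' (hσ.restrict σ _ _ '' s) = σ '' (Subtype.val '' s) := by
      simp only [Set.image_image, Set.MapsTo.val_restrict_apply]
    ext t
    constructor
    · rintro ⟨s, hs, hst⟩
      lift s to Set M.E using (hC.dep hs).subset_ground
      exact ⟨s, hs, Subtype.val_injective.image_injective ((comm s).trans hst)⟩
    · rintro ⟨s, hs, rfl⟩
      exact ⟨_, hs, (comm s).symm⟩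
  refine hasIsomorphicOSAlgebras_of_linearEquiv f fun x => ?_
  rw [hC.osIdeal_eq R, hD.osIdeal_eq R, TwoSidedIdeal.mem_asIdeal, TwoSidedIdeal.mem_asIdeal,
    himage]
  refine map_mem_boundaryIdeal_iff f (fun s hs x hx y hy hxy => Subtype.ext ?_)
    (fun s hs x hx y hy => ?_) x
  · exact hinj _ hs (Set.mem_image_of_mem _ hx) (Set.mem_image_of_mem _ hy)
      (congrArg Subtype.val hxy)
  · exact hf _ hs x y (Set.mem_image_of_mem _ hx) (Set.mem_image_of_mem _ hy)

end GeneratesDep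

end OSIdeal

section DepGenerators

variable {α β : Type*} {M : Matroid α} {N : Matroid β}

theorem generatesDep_setOf_dep (M : Matroid α) : GeneratesDep M {s | M.Dep s} :=
  ⟨fun _ => id, fun S hS => .inl ⟨S, hS, subset_rfl⟩⟩

theorem generatesDep_isthmus : GeneratesDep isthmus ∅ :=
  ⟨fun _ => False.elim, fun S hS => (hS.not_indep (by simp [isthmus])).elim⟩

theorem sum_dep_iff {S : Set (α ⊕ β)} (hS : S ⊆ (M.sum N).E) :
    (M.sum N).Dep S ↔ M.Dep (Sum.inl ⁻¹' S) ∨ N.Dep (Sum.inr ⁻¹' S) := by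
  rw [Matroid.sum_ground] at hS
  have hl : Sum.inl ⁻¹' S ⊆ M.E := fun x hx => by simpa using hS hx
  have hr : Sum.inr ⁻¹' S ⊆ N.E := fun x hx => by simpa using hS hx
  rw [← Matroid.not_indep_iff, Matroid.sum_indep_iff, not_and_or, Matroid.not_indep_iff,
    Matroid.not_indep_iff]

namespace GeneratesDep

variable {C : Set (Set α)} {D : Set (Set β)}

theorem exists_of_dep_preimage (hC : GeneratesDep M C) {f : α → β} (hf : f.Injective)
    (hCD : Set.MapsTo (Set.image f) C D) {S : Set β} (hS : M.Dep (f ⁻¹' S)) :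
    (∃ s ∈ D, s ⊆ S) ∨
      ∃ b s t, insert b s ∈ D ∧ insert b t ∈ D ∧ Disjoint s t ∧ s ∪ t ⊆ S := by
  rcases hC.exists_of_dep hS with ⟨s, hs, hsS⟩ | ⟨b, s, t, hs, ht, hst, hsub⟩
  · exact .inl ⟨f '' s, hCD hs, Set.image_subset_iff.2 hsS⟩
  · refine .inr ⟨f b, f '' s, f '' t, Set.image_insert_eq ▸ hCD hs, Set.image_insert_eq ▸ hCD ht,
      (Set.disjoint_image_iff hf).2 hst, ?_⟩
    rwa [← Set.image_union, Set.image_subset_iff]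

protected theorem sum (hC : GeneratesDep M C) (hD : GeneratesDep N D) :
    GeneratesDep (M.sum N) (Set.image Sum.inl '' C ∪ Set.image Sum.inr '' D) where
  dep := by
    rintro _ (⟨s, hs, rfl⟩ | ⟨s, hs, rfl⟩)
    · have hsub : Sum.inl '' s ⊆ (M.sum N).E :=
        Matroid.sum_ground M N ▸
          Set.subset_union_of_subset_left (Set.image_mono (hC.dep hs).subset_ground) _
      rw [sum_dep_iff hsub, Set.preimage_image_eq _ Sum.inl_injective]
      exact .inl (hC.dep hs)
    · have hsub : Sum.inr '' s ⊆ (M.sum N).E :=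
        Matroid.sum_ground M N ▸
          Set.subset_union_of_subset_right (Set.image_mono (hD.dep hs).subset_ground) _
      rw [sum_dep_iff hsub, Set.preimage_image_eq _ Sum.inr_injective]
      exact .inr (hD.dep hs)
  exists_of_dep S hS := by
    rcases (sum_dep_iff hS.subset_ground).1 hS with hS | hS
    · exact hC.exists_of_dep_preimage Sum.inl_injective (fun s hs => .inl ⟨s, hs, rfl⟩) hS
    · exact hD.exists_of_dep_preimage Sum.inr_injective (fun s hs => .inr ⟨s, hs, rfl⟩) hS

end GeneratesDep

end DepGenerators

section TwoSets

variable {γ : Type*} {P : Matroid γ} [P.RankFinite] {E₀ E₁ : Set γ} {b : γ}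

theorem indep_sdiff_union_of_eRk_add_eRk_le (hE : P.E = E₀ ∪ E₁) (hb : b ∈ E₁)
    (hr : P.eRk E₀ + P.eRk E₁ ≤ P.eRank + 1) {S₀ S₁ : Set γ} (h₀ : P.Indep (insert b S₀))
    (hS₀ : insert b S₀ ⊆ E₀) (h₁ : P.Indep S₁) (hS₁ : S₁ ⊆ E₁) : P.Indep (S₀ \ {b} ∪ S₁) := by
  obtain ⟨B₀, hB₀, hSB₀⟩ := h₀.subset_isBasis_of_subset hS₀ (hE ▸ Set.subset_union_left)
  obtain ⟨B₁, hB₁, hSB₁⟩ := h₁.subset_isBasis_of_subset hS₁ (hE ▸ Set.subset_union_right)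
  have hbB₀ : b ∈ B₀ := hSB₀ (Set.mem_insert _ _)
  have hspan : P.eRk (B₀ \ {b} ∪ B₁) = P.eRank := by
    have hunion : E₁ ∪ B₀ \ {b} = B₀ ∪ E₁ := by
      grind
    rw [Set.union_comm, hB₁.eRk_eq_eRk_union, hunion, hB₀.eRk_eq_eRk_union, ← hE,
      Matroid.eRk_ground]
  have hcard : (B₀ \ {b} ∪ B₁).encard + 1 ≤ P.eRank + 1 := calc
    _ ≤ (B₀ \ {b}).encard + 1 + B₁.encard := by
      rw [add_right_comm]
      gcongr
      exact Set.encard_union_le _ _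
    _ = P.eRk E₀ + P.eRk E₁ := by
      rw [Set.encard_sdiff_singleton_add_one hbB₀, hB₀.encard_eq_eRk, hB₁.encard_eq_eRk]
    _ ≤ P.eRank + 1 := hr
  refine (Matroid.IsRkFinite.indep_of_encard_le_eRk (P.isRkFinite_set _) ?_).subset
    (Set.union_subset_union (Set.sdiff_subset_sdiff_left ((Set.subset_insert _ _).trans hSB₀)) hSB₁)
  rw [hspan]
  exact (ENat.add_le_add_iff_right (by simp)).1 hcard

theorem indep_of_indep_insert_inter (hE : P.E = E₀ ∪ E₁) (hb : b ∈ E₀ ∩ E₁)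
    (hr : P.eRk E₀ + P.eRk E₁ ≤ P.eRank + 1) {S : Set γ} (hS : S ⊆ P.E)
    (h₀ : P.Indep (insert b (S ∩ E₀))) (h₁ : P.Indep (S ∩ E₁)) : P.Indep S := by
  refine (indep_sdiff_union_of_eRk_add_eRk_le hE hb.2 hr h₀
    (Set.insert_subset hb.1 Set.inter_subset_right) h₁ Set.inter_subset_right).subset
      fun x hx => ?_
  by_cases hxb : x = b
  · exact .inr ⟨hx, hxb ▸ hb.2⟩
  · exact (hE ▸ hS hx : x ∈ E₀ ∪ E₁).imp (fun h => ⟨⟨hx, h⟩, hxb⟩) fun h => ⟨hx, h⟩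

theorem generatesDep_of_eRk_add_eRk_le (hE : P.E = E₀ ∪ E₁) (hb : E₀ ∩ E₁ = {b})
    (hr : P.Indep {b} → P.eRk E₀ + P.eRk E₁ ≤ P.eRank + 1) :
    GeneratesDep P ({s | P.Dep s ∧ s ⊆ E₀} ∪ {s | P.Dep s ∧ s ⊆ E₁}) where
  dep := by
    rintro s (hs | hs)
    exacts [hs.1, hs.1]
  exists_of_dep S hS := by
    have hmem : b ∈ E₀ ∩ E₁ := hb.symm.subset rfl
    have hsub (E : Set γ) : insert b (S ∩ E) ⊆ P.E := Set.insert_subset (hE ▸ .inl hmem.1)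
      (Set.inter_subset_left.trans hS.subset_ground)
    by_contra! hcon
    obtain ⟨hinter, hinsert⟩ := hcon
    have h₀ : P.Indep (S ∩ E₀) := by
      by_contra h
      exact hinter _ (.inl ⟨⟨h, (Set.subset_insert _ _).trans (hsub _)⟩, Set.inter_subset_right⟩)
        Set.inter_subset_left
    have h₁ : P.Indep (S ∩ E₁) := by
      by_contra h
      exact hinter _ (.inr ⟨⟨h, (Set.subset_insert _ _).trans (hsub _)⟩, Set.inter_subset_right⟩)
        Set.inter_subset_left
    have h₀' : ¬ P.Indep (insert b (S ∩ E₀)) := fun h => hS.not_indep <|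
      indep_of_indep_insert_inter hE hmem (hr (h.subset (by simp))) hS.subset_ground h h₁
    have h₁' : ¬ P.Indep (insert b (S ∩ E₁)) := fun h => hS.not_indep <|
      indep_of_indep_insert_inter (hE.trans (Set.union_comm _ _)) hmem.symm
        (add_comm (P.eRk E₀) _ ▸ hr (h.subset (by simp))) hS.subset_ground h h₀
    have hbS : b ∉ S := fun hbS =>
      h₀' ((Set.insert_eq_of_mem (s := S ∩ E₀) ⟨hbS, hmem.1⟩).symm ▸ h₀)
    refine hinsert b _ _ (.inl ⟨⟨h₀', hsub _⟩, Set.insert_subset hmem.1 Set.inter_subset_right⟩)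
      (.inr ⟨⟨h₁', hsub _⟩, Set.insert_subset hmem.2 Set.inter_subset_right⟩) ?_
      (Set.union_subset Set.inter_subset_left Set.inter_subset_left)
    refine Set.disjoint_left.2 fun x hx₀ hx₁ => hbS ?_
    rw [← show x = b from hb.subset ⟨hx₀.2, hx₁.2⟩]
    exact hx₀.1

end TwoSets

section PrincipalTruncation

variable {α : Type*} {M : Matroid α} {Z : Set α}

theorem exists_insert_insert_indep_of_encard_lt {I J : Set α} {z z' : α} (hz : z ∈ Z) (hzI : z ∉ I)
    (hI : M.Indep (insert z I)) (hz' : z' ∈ Z) (hzJ : z' ∉ J) (hJ : M.Indep (insert z' J))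
    (hcard : I.encard < J.encard) :
    ∃ e ∈ J, e ∉ I ∧ ∃ w ∈ Z, w ∉ insert e I ∧ M.Indep (insert w (insert e I)) := by
  -- The point `w` must be chosen so that augmenting `insert w I` from `insert z' J` avoids `z'`.
  obtain ⟨w, hw, hwI, hIw, hwz'⟩ : ∃ w ∈ Z, w ∉ I ∧ M.Indep (insert w I) ∧
      (z' ∉ insert w I → ¬ M.Indep (insert z' (insert w I))) := by
    by_cases h : z' ∉ I ∧ M.Indep (insert z' I)
    · exact ⟨z', hz', h.1, h.2, fun h => (h (Set.mem_insert _ _)).elim⟩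
    · exact ⟨z, hz, hzI, hI, fun hn hi => h ⟨fun h => hn (.inr h), hi.subset (by grind)⟩⟩
  have hcard' : (insert w I).encard < (insert z' J).encard := by
    rw [Set.encard_insert_of_notMem hwI, Set.encard_insert_of_notMem hzJ]
    exact (ENat.add_lt_add_iff_right (by simp)).2 hcard
  obtain ⟨e, ⟨heJ, heI⟩, he⟩ := hIw.exists_insert_of_encard_lt hJ hcard'
  rcases heJ with rfl | heJ
  · exact (hwz' heI he).elim
  · exact ⟨e, heJ, by grind, w, hw, by grind, Set.insert_comm .. ▸ he⟩

variable [M.RankFinite]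

/-- The principal truncation of `M` along `Z`: a point freely added to the flat spanned by `Z` is
contracted. A set is independent if some point of `Z` extends it to an independent set of `M`. -/
def principalTruncation (M : Matroid α) [M.RankFinite] (Z : Set α) (hZ : ∃ z ∈ Z, M.Indep {z}) :
    Matroid α :=
  (IndepMatroid.ofBddAugment M.E (fun I => ∃ z ∈ Z, z ∉ I ∧ M.Indep (insert z I))
    (by simpa using hZ)
    (fun I J ⟨z, hz, hzJ, hJ⟩ hIJ => ⟨z, hz, fun h => hzJ (hIJ h), hJ.subset (by gcongr)⟩)
    (fun I J ⟨_, hz, hzI, hI⟩ ⟨_, hz', hzJ, hJ⟩ =>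
      exists_insert_insert_indep_of_encard_lt hz hzI hI hz' hzJ hJ)
    (by
      obtain ⟨n, hn⟩ := ENat.ne_top_iff_exists.1 (M.eRank_ne_top_iff.2 ‹_›)
      exact ⟨n, fun I ⟨z, _, _, hI⟩ => hn ▸ (hI.subset (Set.subset_insert _ _)).encard_le_eRank⟩)
    (fun I ⟨z, _, _, hI⟩ => (Set.subset_insert _ _).trans hI.subset_ground)).matroid

variable {hZ : ∃ z ∈ Z, M.Indep {z}}

theorem principalTruncation_ground : (principalTruncation M Z hZ).E = M.E := rfl

theorem principalTruncation_indep_iff {I : Set α} : (principalTruncation M Z hZ).Indep I ↔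
    ∃ z ∈ Z, z ∉ I ∧ M.Indep (insert z I) := Iff.rfl

end PrincipalTruncation

section PointedUnion

variable {α β γ : Type*} {G₀ : Matroid α} {G₁ : Matroid β} {P : Matroid γ}

namespace IsSubmatroidEmbedding

variable {f : α → γ}

theorem of_indep_image_iff (hinj : Set.InjOn f G₀.E) (hsub : f '' G₀.E ⊆ P.E)
    (h : ∀ s ⊆ G₀.E, P.Indep (f '' s) ↔ G₀.Indep s) : IsSubmatroidEmbedding G₀ P f where
  injOn := hinj
  image_subset := hsub
  restrict_eq := by
    refine Matroid.ext_indep rfl fun t ht => ?_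
    obtain ⟨s, hs, rfl⟩ := Set.subset_image_iff.1 ht
    exact Matroid.restrict_indep_iff.trans <| (and_iff_left ht).trans <|
      (h s hs).trans (Matroid.map_image_indep_iff hs).symm

theorem indep_image_iff (hf : IsSubmatroidEmbedding G₀ P f) {s : Set α} (hs : s ⊆ G₀.E) :
    P.Indep (f '' s) ↔ G₀.Indep s := by
  rw [← Matroid.map_image_indep_iff (hf := hf.injOn) hs, ← hf.restrict_eq,
    Matroid.restrict_indep_iff, and_iff_left (Set.image_mono hs)]

theorem dep_image_iff (hf : IsSubmatroidEmbedding G₀ P f) {s : Set α} (hs : s ⊆ G₀.E) :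
    P.Dep (f '' s) ↔ G₀.Dep s := by
  rw [← Matroid.not_indep_iff ((Set.image_mono hs).trans hf.image_subset), hf.indep_image_iff hs,
    Matroid.not_indep_iff]

theorem image_setOf_dep (hf : IsSubmatroidEmbedding G₀ P f) :
    Set.image f '' {s | G₀.Dep s} = {s | P.Dep s ∧ s ⊆ f '' G₀.E} := by
  ext t
  constructor
  · rintro ⟨s, hs, rfl⟩
    exact ⟨(hf.dep_image_iff hs.subset_ground).2 hs, Set.image_mono hs.subset_ground⟩
  · rintro ⟨ht, htE⟩
    obtain ⟨s, hs, rfl⟩ := Set.subset_image_iff.1 htE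
    exact ⟨s, (hf.dep_image_iff hs).1 ht, rfl⟩

theorem eRk_image_ground (hf : IsSubmatroidEmbedding G₀ P f) : P.eRk (f '' G₀.E) = G₀.eRank := by
  rw [← Matroid.eRank_restrict, hf.restrict_eq, Matroid.eRank_map]

end IsSubmatroidEmbedding

theorem isBase_sum_of_isBase {B₀ : Set α} {B₁ : Set β} (h₀ : G₀.IsBase B₀) (h₁ : G₁.IsBase B₁) :
    (G₀.sum G₁).IsBase (Sum.inl '' B₀ ∪ Sum.inr '' B₁) := by
  simpa [Set.preimage_image_eq _ Sum.inl_injective, Set.preimage_image_eq _ Sum.inr_injective]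
    using ⟨h₀, h₁⟩

instance rankFinite_sum [G₀.RankFinite] [G₁.RankFinite] : (G₀.sum G₁).RankFinite := by
  obtain ⟨B₀, h₀⟩ := G₀.exists_isBase
  obtain ⟨B₁, h₁⟩ := G₁.exists_isBase
  exact (isBase_sum_of_isBase h₀ h₁).rankFinite_of_finite
    ((h₀.finite.image _).union (h₁.finite.image _))

theorem indep_insert_inl_image_inr {p : α} {s : Set β} (hp : G₀.Indep {p}) :
    (G₀.sum G₁).Indep (insert (Sum.inl p) (Sum.inr '' s)) ↔ G₁.Indep s := by
  have hl : Sum.inl ⁻¹' (insert (Sum.inl p) (Sum.inr '' s : Set (α ⊕ β))) = {p} := by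
    ext; simp
  have hr : Sum.inr ⁻¹' (insert (Sum.inl p) (Sum.inr '' s : Set (α ⊕ β))) = s := by
    ext; simp
  rw [Matroid.sum_indep_iff, hl, hr, and_iff_right hp]

theorem indep_insert_inr_image_inl {q : β} {s : Set α} (hq : G₁.Indep {q}) :
    (G₀.sum G₁).Indep (insert (Sum.inr q) (Sum.inl '' s)) ↔ G₀.Indep s := by
  have hl : Sum.inl ⁻¹' (insert (Sum.inr q) (Sum.inl '' s : Set (α ⊕ β))) = s := by
    ext; simp
  have hr : Sum.inr ⁻¹' (insert (Sum.inr q) (Sum.inl '' s : Set (α ⊕ β))) = {q} := by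
    ext; simp
  rw [Matroid.sum_indep_iff, hl, hr, and_iff_left hq]

theorem eRank_le_eRank_principalTruncation_delete {M : Matroid α} [M.RankFinite] {Z : Set α}
    {hZ : ∃ z ∈ Z, M.Indep {z}} {B : Set α} {z : α} (hB : M.IsBase B) (hzB : z ∈ B) (hz : z ∈ Z) :
    M.eRank ≤ (principalTruncation M Z hZ ＼ {z}).eRank + 1 := by
  have hI : (principalTruncation M Z hZ ＼ {z}).Indep (B \ {z}) :=
    Matroid.delete_indep_iff.2 ⟨⟨z, hz, by simp, by simpa [hzB] using hB.indep⟩,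
      Set.disjoint_sdiff_left⟩
  rw [← hB.encard_eq_eRank, ← Set.encard_sdiff_singleton_add_one hzB]
  gcongr
  exact hI.encard_le_eRank

section ParallelConnection

variable [G₀.RankFinite] [G₁.RankFinite] {p : α} {hp : G₀.Indep {p}} {q : β}

/-- The parallel connection of `(G₀, p)` and `(G₁, q)`, realized on the sum of the ground sets with
the point `q` removed, so that `p` is the base point. It is obtained from the direct sum by a
truncation that makes `p` and `q` parallel. -/
def parallelConnection (G₀ : Matroid α) (G₁ : Matroid β) [G₀.RankFinite] [G₁.RankFinite] {p : α}
    (hp : G₀.Indep {p}) (q : β) : Matroid (α ⊕ β) :=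
  principalTruncation (G₀.sum G₁) {Sum.inl p, Sum.inr q}
    ⟨Sum.inl p, by simp, by simpa using (indep_insert_inl_image_inr hp).2 G₁.empty_indep⟩ ＼
      {Sum.inr q}

theorem parallelConnection_ground :
    (parallelConnection G₀ G₁ hp q).E = (Sum.inl '' G₀.E ∪ Sum.inr '' G₁.E) \ {Sum.inr q} := by
  rw [parallelConnection, Matroid.delete_ground, principalTruncation_ground, Matroid.sum_ground]

theorem parallelConnection_indep_iff {I : Set (α ⊕ β)} :
    (parallelConnection G₀ G₁ hp q).Indep I ↔ (∃ z ∈ ({Sum.inl p, Sum.inr q} : Set (α ⊕ β)),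
      z ∉ I ∧ (G₀.sum G₁).Indep (insert z I)) ∧ Sum.inr q ∉ I := by
  rw [parallelConnection, Matroid.delete_indep_iff, principalTruncation_indep_iff,
    Set.disjoint_singleton_right]

theorem parallelConnection_indep_image_inl_iff (hq : G₁.Indep {q}) {s : Set α} :
    (parallelConnection G₀ G₁ hp q).Indep (Sum.inl '' s) ↔ G₀.Indep s := by
  rw [parallelConnection_indep_iff, and_iff_left (by simp)]
  refine ⟨fun ⟨z, _, _, hz⟩ => ?_, fun hs => ⟨Sum.inr q, by simp, by simp,
    (indep_insert_inr_image_inl hq).2 hs⟩⟩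
  exact ((Matroid.sum_indep_iff _ _).1 hz).1.subset fun x hx => .inr ⟨x, hx, rfl⟩

theorem parallelConnection_indep_image_update_inr_iff [DecidableEq β] {s : Set β} :
    (parallelConnection G₀ G₁ hp q).Indep (Function.update Sum.inr q (Sum.inl p) '' s) ↔
      G₁.Indep s := by
  rw [parallelConnection_indep_iff, and_iff_left (by grind)]
  constructor
  · rintro ⟨z, hz, hzs, hI⟩
    refine ((Matroid.sum_indep_iff _ _).1 hI).2.subset fun x hx => ?_
    by_cases hxq : x = q
    · subst hxq
      have : z ≠ Sum.inl p := fun h => hzs ⟨x, hx, by simp [h]⟩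
      exact .inl (hz.resolve_left this).symm
    · exact .inr ⟨x, hx, by simp [hxq]⟩
  · intro hs
    obtain ⟨z, hz, hzs, hins⟩ : ∃ z ∈ ({Sum.inl p, Sum.inr q} : Set (α ⊕ β)),
        z ∉ Function.update Sum.inr q (Sum.inl p) '' s ∧
        insert z (Function.update Sum.inr q (Sum.inl p) '' s) =
          insert (Sum.inl p) (Sum.inr '' s) := by
      by_cases hqs : q ∈ s
      · exact ⟨Sum.inr q, by simp, by grind, by ext; grind⟩
      · exact ⟨Sum.inl p, by simp, by grind, by grind⟩
    exact ⟨z, hz, hzs, hins ▸ (indep_insert_inl_image_inr hp).2 hs⟩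

theorem eRank_add_eRank_le_eRank_parallelConnection (hq : G₁.Indep {q}) :
    G₀.eRank + G₁.eRank ≤ (parallelConnection G₀ G₁ hp q).eRank + 1 := by
  obtain ⟨B₀, hB₀⟩ := G₀.exists_isBase
  obtain ⟨B₁, hB₁, hqB₁⟩ := hq.exists_isBase_superset
  have hB := isBase_sum_of_isBase hB₀ hB₁
  calc
    G₀.eRank + G₁.eRank = (G₀.sum G₁).eRank := by
      rw [← hB.encard_eq_eRank, Set.encard_union_eq Set.disjoint_image_inl_image_inr,
        Sum.inl_injective.encard_image, Sum.inr_injective.encard_image, hB₀.encard_eq_eRank,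
        hB₁.encard_eq_eRank]
    _ ≤ (parallelConnection G₀ G₁ hp q).eRank + 1 :=
      eRank_le_eRank_principalTruncation_delete hB (by simpa using hqB₁) (by simp)

end ParallelConnection

variable {p : α} {q : β}

/-- The maps `f₀` and `f₁` identify `E₀` and `E₁` with two sets whose union is the wedge of the
pointed sets `(E₀, p)` and `(E₁, q)`. -/
structure IsWedge (E₀ : Set α) (p : α) (E₁ : Set β) (q : β) (f₀ : α → γ) (f₁ : β → γ) :
    Prop where
  mem_left : p ∈ E₀
  mem_right : q ∈ E₁
  injOn_left : Set.InjOn f₀ E₀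
  injOn_right : Set.InjOn f₁ E₁
  apply_eq : f₀ p = f₁ q
  image_inter_image : f₀ '' E₀ ∩ f₁ '' E₁ = {f₀ p}

namespace IsWedge

variable {E₀ : Set α} {E₁ : Set β} {f₀ : α → γ} {f₁ : β → γ}

theorem bijOn (h : IsWedge E₀ p E₁ q f₀ f₁) :
    Set.BijOn (Sum.elim f₀ f₁) ((Sum.inl '' E₀ ∪ Sum.inr '' E₁) \ {Sum.inr q})
      (f₀ '' E₀ ∪ f₁ '' E₁) := by
  have hdisj {x : α} {y : β} (hx : x ∈ E₀) (hy : y ∈ E₁) (hxy : f₀ x = f₁ y) : y = q :=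
    h.injOn_right hy h.mem_right <| hxy.symm.trans <|
      (h.image_inter_image.subset ⟨⟨x, hx, rfl⟩, ⟨y, hy, hxy.symm⟩⟩).trans h.apply_eq
  refine ⟨?_, ?_, ?_⟩
  · rintro _ ⟨⟨x, hx, rfl⟩ | ⟨y, hy, rfl⟩, -⟩
    exacts [.inl ⟨x, hx, rfl⟩, .inr ⟨y, hy, rfl⟩]
  · rintro _ ⟨⟨x, hx, rfl⟩ | ⟨x, hx, rfl⟩, hxq⟩ _ ⟨⟨y, hy, rfl⟩ | ⟨y, hy, rfl⟩, hyq⟩ hxy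
    · exact congrArg _ (h.injOn_left hx hy hxy)
    · exact (hyq (congrArg _ (hdisj hx hy hxy))).elim
    · exact (hxq (congrArg _ (hdisj hy hx hxy.symm))).elim
    · exact congrArg _ (h.injOn_right hx hy hxy)
  · rintro _ (⟨x, hx, rfl⟩ | ⟨y, hy, rfl⟩)
    · exact ⟨Sum.inl x, by simp [hx], rfl⟩
    · by_cases hyq : y = q
      · exact ⟨Sum.inl p, by simp [h.mem_left], hyq ▸ h.apply_eq⟩
      · exact ⟨Sum.inr y, by simp [hy, hyq], rfl⟩

theorem exists_isPointedUnion [G₀.RankFinite] [G₁.RankFinite] (h : IsWedge G₀.E p G₁.E q f₀ f₁)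
    (hp : G₀.Indep {p}) (hq : G₁.Indep {q}) :
    ∃ Q : Matroid γ, IsPointedUnion G₀ p G₁ q Q (f₀ p) ∧ G₀.eRank + G₁.eRank ≤ Q.eRank + 1 := by
  classical
  have hinj : Set.InjOn (Sum.elim f₀ f₁) (parallelConnection G₀ G₁ hp q).E := by
    simpa only [parallelConnection_ground] using h.bijOn.injOn
  have hground : ((parallelConnection G₀ G₁ hp q).map _ hinj).E = f₀ '' G₀.E ∪ f₁ '' G₁.E := by
    rw [Matroid.map_ground, parallelConnection_ground, h.bijOn.image_eq]
  refine ⟨(parallelConnection G₀ G₁ hp q).map _ hinj, ⟨h.mem_left, h.mem_right, f₀, f₁,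
    .of_indep_image_iff h.injOn_left (hground ▸ Set.subset_union_left) fun s hs => ?_,
    .of_indep_image_iff h.injOn_right (hground ▸ Set.subset_union_right) fun s hs => ?_,
    rfl, h.apply_eq.symm, hground, h.image_inter_image⟩, ?_⟩
  · have hsub : Sum.inl '' s ⊆ (parallelConnection G₀ G₁ hp q).E := by
      grind [parallelConnection_ground]
    have himage : f₀ '' s = Sum.elim f₀ f₁ '' (Sum.inl '' s) := by
      rw [← Set.image_comp, Sum.elim_comp_inl]
    rw [himage, Matroid.map_image_indep_iff hsub,
      parallelConnection_indep_image_inl_iff hq]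
  · have hsub : Function.update Sum.inr q (Sum.inl p) '' s ⊆
        (parallelConnection G₀ G₁ hp q).E := by
      grind [parallelConnection_ground, h.mem_left]
    have himage : f₁ '' s = Sum.elim f₀ f₁ '' (Function.update Sum.inr q (Sum.inl p) '' s) := by
      rw [← Set.image_comp, Function.comp_update, Sum.elim_inl, Sum.elim_comp_inr, h.apply_eq,
        Function.update_eq_self]
    rw [himage, Matroid.map_image_indep_iff hsub,
      parallelConnection_indep_image_update_inr_iff]
  · rw [Matroid.eRank_map]
    exact eRank_add_eRank_le_eRank_parallelConnection hq

end IsWedge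

end PointedUnion

section PointedLinearEquiv

theorem exists_linearEquiv_single_sub_single (R : Type*) [CommRing R] {X Y : Type*}
    [DecidableEq X] (e : X ≃ Y) {p q : X} {B : Set X} (hp : p ∉ B) (hq : q ∈ B) :
    ∃ f : (X →₀ R) ≃ₗ[R] (Y →₀ R), ∀ x y : X, (x ∈ B ↔ y ∈ B) →
      f (Finsupp.single x 1 - Finsupp.single y 1) =
        Finsupp.single (Function.update e q (e p) x) 1 -
          Finsupp.single (Function.update e q (e p) y) 1 := by
  classical
  let φ : (X →₀ R) →ₗ[R] R := Finsupp.linearCombination R ((B \ {q}).indicator (1 : X → R))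
  have hφ (x : X) : φ (Finsupp.single x 1) = (B \ {q}).indicator (1 : X → R) x := by
    rw [Finsupp.linearCombination_single, one_smul]
  have hφv : φ (Finsupp.single q 1 - Finsupp.single p 1) = 0 := by
    simp [hφ, hp]
  let f : (X →₀ R) ≃ₗ[R] (Y →₀ R) := LinearEquiv.transvection hφv ≪≫ₗ Finsupp.domLCongr e
  have hf (x : X) : f (Finsupp.single x 1) = Finsupp.single (Function.update e q (e p) x) 1 +
      B.indicator (1 : X → R) x • (Finsupp.single (e q) 1 - Finsupp.single (e p) 1) := by
    rw [LinearEquiv.trans_apply, LinearEquiv.transvection.apply, hφ, map_add, map_smul, map_sub,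
      Finsupp.domLCongr_single, Finsupp.domLCongr_single, Finsupp.domLCongr_single]
    by_cases hxq : x = q
    · simp [hxq, hq]
    · simp [hxq, Set.indicator_apply]
  refine ⟨f, fun x y hxy => ?_⟩
  have hind : B.indicator (1 : X → R) x = B.indicator 1 y := by
    simp only [Set.indicator_apply, hxy, Pi.one_apply]
  rw [map_sub, hf, hf, hind, add_sub_add_right_eq_sub]

theorem exists_linearEquiv_single_sub_single_of_bijOn (R : Type*) [CommRing R] {α β : Type*}
    {A : Set α} {A' : Set β} {σ : α → β} (hσ : Set.MapsTo σ A A') {p q : A} {z : β} (hz : z ∈ A')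
    (hbij : Set.BijOn σ (A \ {↑q}) (A' \ {z})) (hpq : σ p = σ q) {B : Set A} (hp : p ∉ B)
    (hq : q ∈ B) :
    ∃ f : (A →₀ R) ≃ₗ[R] (A' →₀ R), ∀ x y : A, (x ∈ B ↔ y ∈ B) →
      f (Finsupp.single x 1 - Finsupp.single y 1) =
        Finsupp.single (hσ.restrict σ _ _ x) 1 - Finsupp.single (hσ.restrict σ _ _ y) 1 := by
  classical
  have hupdate : Set.BijOn (Function.update σ q z) A A' := by
    have heq : Set.EqOn σ (Function.update σ q z) (A \ {↑q}) := fun x hx =>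
      (Function.update_of_ne hx.2 _ _).symm
    have := (hbij.congr heq).insert (a := ↑q) (by simp)
    rwa [Function.update_self, Set.insert_sdiff_self_of_mem q.2,
      Set.insert_sdiff_self_of_mem hz] at this
  have hne : (p : α) ≠ q := Subtype.coe_ne_coe.2 (ne_of_mem_of_not_mem hq hp).symm
  have hrestrict : hσ.restrict σ _ _ =
      Function.update (hupdate.equiv _) q (hupdate.equiv _ p) := by
    refine Function.eq_update_iff.2 ⟨Subtype.ext ?_, fun x hx => Subtype.ext ?_⟩
    · exact hpq.symm.trans (Function.update_of_ne hne _ _).symm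
    · exact (Function.update_of_ne (Subtype.coe_ne_coe.2 hx) _ _).symm
  exact hrestrict ▸ exists_linearEquiv_single_sub_single R (hupdate.equiv _) hp hq

end PointedLinearEquiv

section ParallelConnection

variable {α β γ : Type*} {G₀ : Matroid α} {G₁ : Matroid β} {P : Matroid γ} {p : α} {q : β} {b : γ}

theorem IsParallelConnection.exists_isWedge [G₀.RankFinite] [G₁.RankFinite]
    (hP : IsParallelConnection G₀ p G₁ q P b) :
    ∃ (f₀ : α → γ) (f₁ : β → γ), IsWedge G₀.E p G₁.E q f₀ f₁ ∧
      P.E = f₀ '' G₀.E ∪ f₁ '' G₁.E ∧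
      GeneratesDep P (Set.image f₀ '' {s | G₀.Dep s} ∪ Set.image f₁ '' {s | G₁.Dep s}) := by
  obtain ⟨⟨hp, hq, f₀, f₁, hf₀, hf₁, rfl, hfq, hE, hinter⟩, hmax⟩ := hP
  have hwedge : IsWedge G₀.E p G₁.E q f₀ f₁ := ⟨hp, hq, hf₀.injOn, hf₁.injOn, hfq.symm, hinter⟩
  have : P.RankFinite := by
    rw [← Matroid.isRkFinite_ground_iff_rankFinite, hE]
    refine .union ?_ ?_ <;> rw [← Matroid.eRk_ne_top_iff]
    · rwa [hf₀.eRk_image_ground, Matroid.eRank_ne_top_iff]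
    · rwa [hf₁.eRk_image_ground, Matroid.eRank_ne_top_iff]
  refine ⟨f₀, f₁, hwedge, hE, ?_⟩
  rw [hf₀.image_setOf_dep, hf₁.image_setOf_dep]
  refine generatesDep_of_eRk_add_eRk_le hE hinter fun hb => ?_
  have hp' : G₀.Indep {p} := by
    rwa [← hf₀.indep_image_iff (by simpa), Set.image_singleton]
  have hq' : G₁.Indep {q} := by
    rwa [← hf₁.indep_image_iff (by simpa), Set.image_singleton, hfq]
  obtain ⟨Q, hQ, hrank⟩ := hwedge.exists_isPointedUnion hp' hq'
  rw [hf₀.eRk_image_ground, hf₁.eRk_image_ground]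
  exact hrank.trans (by gcongr; exact hmax Q _ hQ)

theorem isthmus_sum_ground_sdiff : (isthmus.sum P).E \ {Sum.inl ()} = Sum.inr '' P.E := by
  ext (x | x) <;> simp [isthmus]

theorem IsWedge.hasIsomorphicOSAlgebras (R : Type*) [CommRing R] {f₀ : α → γ} {f₁ : β → γ}
    (h : IsWedge G₀.E p G₁.E q f₀ f₁) (hE : P.E = f₀ '' G₀.E ∪ f₁ '' G₁.E)
    (hP : GeneratesDep P (Set.image f₀ '' {s | G₀.Dep s} ∪ Set.image f₁ '' {s | G₁.Dep s})) :
    HasIsomorphicOSAlgebras R (G₀.sum G₁) (isthmus.sum P) := by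
  let σ : α ⊕ β → Unit ⊕ γ := Sum.inr ∘ Sum.elim f₀ f₁
  have hσ : Set.MapsTo σ (G₀.sum G₁).E (isthmus.sum P).E := by
    rintro (x | x) hx <;> simp_all [σ] <;> grind
  have hbij : Set.BijOn σ ((G₀.sum G₁).E \ {Sum.inr q}) ((isthmus.sum P).E \ {Sum.inl ()}) := by
    rw [isthmus_sum_ground_sdiff, Matroid.sum_ground, hE]
    exact Sum.inr_injective.injOn.bijOn_image.comp h.bijOn
  obtain ⟨f, hf⟩ := exists_linearEquiv_single_sub_single_of_bijOn R hσ
    (p := ⟨Sum.inl p, by simpa using h.mem_left⟩) (q := ⟨Sum.inr q, by simpa using h.mem_right⟩)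
    (B := {x | x.1.isRight}) (by simp [isthmus]) hbij (congrArg Sum.inr h.apply_eq) (by simp)
    (by simp)
  have hdep : GeneratesDep (isthmus.sum P) (Set.image σ ''
      (Set.image Sum.inl '' {s | G₀.Dep s} ∪ Set.image Sum.inr '' {s | G₁.Dep s})) := by
    convert generatesDep_isthmus.sum hP using 1
    simp only [Set.image_union, Set.image_image, Set.image_empty, Set.empty_union]
    rfl
  refine ((generatesDep_setOf_dep G₀).sum (generatesDep_setOf_dep G₁)).hasIsomorphicOSAlgebras hσ
    hdep ?_ f ?_
  · rintro _ (⟨s, hs, rfl⟩ | ⟨s, hs, rfl⟩)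
    · exact .image_of_comp (g := σ)
        (Sum.inr_injective.comp_injOn (h.injOn_left.mono hs.subset_ground))
    · exact .image_of_comp (g := σ)
        (Sum.inr_injective.comp_injOn (h.injOn_right.mono hs.subset_ground))
  · rintro _ (⟨s, _, rfl⟩ | ⟨s, _, rfl⟩) x y hx hy <;> exact hf x y (by grind)

end ParallelConnection

end OrlikSolomon

end

theorem theorem3p9_general {R : Type*} [CommRing R] {α β γ : Type*}
    (G₀ : Matroid α) (G₁ : Matroid β) [G₀.RankFinite] [G₁.RankFinite] (p : α) (q : β)
    (P : Matroid γ) (b : γ) (hP : OrlikSolomon.IsParallelConnection G₀ p G₁ q P b) :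
    OrlikSolomon.HasIsomorphicOSAlgebras R (G₀.sum G₁) (OrlikSolomon.isthmus.sum P) := by
  obtain ⟨f₀, f₁, hwedge, hE, hdep⟩ := hP.exists_isWedge
  exact hwedge.hasIsomorphicOSAlgebras R hE hdep

theorem theorem3p9 {R : Type*} [CommRing R] {α β γ : Type*}
    (G₀ : Matroid α) (G₁ : Matroid β) [G₀.Finite] [G₁.Finite] (p : α) (q : β)
    (P : Matroid γ) (b : γ) (hP : OrlikSolomon.IsParallelConnection G₀ p G₁ q P b) :
    OrlikSolomon.HasIsomorphicOSAlgebras R (G₀.sum G₁) (OrlikSolomon.isthmus.sum P) :=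
  theorem3p9_general G₀ G₁ p q P b hP
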